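/- Theorem 5.1. Let $M$ be a closed (compact, without boundary) smooth Hausdorff 3-manifold, let $1\le r\le\infty$, and let $\mathcal F$ be a codimension-one foliation of $M$ of class $C^r$ (given by an atlas of $C^r$ charts onto $\mathbb R^2\times\mathbb R$ whose changes of coordinates locally have the form $(x,z)\mapsto(f(x,z),h(z))$). Let $X$ be a $C^r$ vector field on $M$ that is tangent to the leaves of $\mathcal F$, that is a gradient field, i.e. $X=-\nabla\Psi$ for some $C^1$ function $\Psi:M\to\mathbb R$ and some Riemannian metric of class $C^r$ on $M$, and that is nondegenerate in the following sense. (a) The fixed point set $\mathrm{Fix}(X)=\{p: X(p)=0\}$ is a link, i.e. the disjoint union of finitely many $C^r$ embedded circles. For $p\in\mathrm{Fix}(X)$ the transverse eigenvalues at $p$ are the two eigenvalues, with multiplicity, induced by the linearization $DX(p)$ on the quotient of $T_pM$ by the tangent line of $\mathrm{Fix}(X)$. (b) At all but finitely many points of $\mathrm{Fix}(X)$ the field $X$ is transversally hyperbolic, i.e. both transverse eigenvalues have nonzero real part. (c) The degeneracy at each exceptional point is of codimension one: along the regularly parametrized curve of fixed points through it, either (saddle-node) the transverse eigenvalues are real,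 one is nonzero at the point, and the other passes through $0$ there with nonzero derivative; or (Hopf) the transverse eigenvalues are complex conjugates $a\pm iw$, with $w\ne0$ at the point, where $a$ passes through $0$ with nonzero derivative. Then $\mathcal F$ is taut: every leaf of $\mathcal F$ meets a closed transversal, i.e. for every leaf $L$ there is a closed $C^r$ curve $\gamma:\mathbb R/\mathbb Z\to M$ that meets $L$ and whose velocity is nowhere tangent to $\mathcal F$. -/

import Mathlib

open scoped Manifold ContDiff
open Bundle

/-- The model space of 3-manifolds. -/
abbrev E3 : Type := EuclideanSpace ℝ (Fin 3)

/-- The model space `ℝ² × ℝ` of foliation charts; the leaf direction is the first factor. -/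
abbrev FolModel : Type := EuclideanSpace ℝ (Fin 2) × ℝ

section

variable {M : Type*} [TopologicalSpace M] [ChartedSpace E3 M]

/-- A codimension-one foliation of class `C^r` of a 3-manifold, given by a foliated atlas: charts
of class `C^r` onto `ℝ² × ℝ` covering the manifold, such that each change of charts has locally the
form `(x, z) ↦ (f (x, z), h z)`. -/
structure CodimOneFoliation (r : ℕ∞) (M : Type*) [TopologicalSpace M] [ChartedSpace E3 M] where
  charts : Set (OpenPartialHomeomorph M FolModel)
  target_eq : ∀ φ ∈ charts, φ.target = Set.univ
  cover : ∀ p : M, ∃ φ ∈ charts, p ∈ φ.source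
  contMDiffOn : ∀ φ ∈ charts, ContMDiffOn (𝓡 3) 𝓘(ℝ, FolModel) r φ φ.source
  contMDiffOn_symm : ∀ φ ∈ charts, ContMDiffOn 𝓘(ℝ, FolModel) (𝓡 3) r φ.symm φ.target
  compatible : ∀ φ ∈ charts, ∀ ψ ∈ charts, ∀ p ∈ φ.source ∩ ψ.source,
    ∃ U : Set M, IsOpen U ∧ p ∈ U ∧ U ⊆ φ.source ∩ ψ.source ∧
      ∀ a ∈ U, ∀ b ∈ U, (φ a).2 = (φ b).2 → (ψ a).2 = (ψ b).2

namespace CodimOneFoliation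

variable {r : ℕ∞} (F : CodimOneFoliation r M)

/-- Two points lie in a common plaque `φ⁻¹(ℝ² × {z})` of the foliated atlas. -/
def SamePlaque (p q : M) : Prop :=
  ∃ φ ∈ F.charts, p ∈ φ.source ∧ q ∈ φ.source ∧ (φ p).2 = (φ q).2

/-- The leaf through `p`: the points that are joined to `p` by a finite chain of plaques. -/
def leaf (p : M) : Set M := {q | Relation.EqvGen F.SamePlaque p q}

/-- The leaves of the foliation. -/
def IsLeaf (L : Set M) : Prop := ∃ p, L = F.leaf p

/-- The plane tangent to the leaf through `p`: the kernel of the differential at `p` of the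
transverse coordinate of a foliation chart (the kernel is the same for all charts around `p`). -/
def tangentPlane (p : M) : Submodule ℝ (TangentSpace (𝓡 3) p) where
  carrier := {v | ∀ φ ∈ F.charts, p ∈ φ.source →
    mfderiv (𝓡 3) 𝓘(ℝ, ℝ) (fun q : M => (φ q).2) p v = 0}
  add_mem' := by
    intro v w hv hw φ hφ hp
    rw [map_add, hv φ hφ hp, hw φ hφ hp, add_zero]
  zero_mem' := by
    intro φ _ _
    exact map_zero _
  smul_mem' := by
    intro c v hv φ hφ hp
    rw [map_smul, hv φ hφ hp, smul_zero]

/-- The vector field `X` is tangent to the leaves of the foliation. -/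
def Contains (X : (p : M) → TangentSpace (𝓡 3) p) : Prop := ∀ p, X p ∈ F.tangentPlane p

/-- A closed transversal: a closed curve of class `C^r` (a map of `ℝ / ℤ`, written as a 1-periodic
map of `ℝ`) whose velocity is nowhere tangent to the foliation. -/
def IsClosedTransversal (γ : ℝ → M) : Prop :=
  ContMDiff 𝓘(ℝ, ℝ) (𝓡 3) r γ ∧ Function.Periodic γ 1 ∧
    ∀ t : ℝ, (mfderiv 𝓘(ℝ, ℝ) (𝓡 3) γ t (1 : ℝ)) ∉ F.tangentPlane (γ t)

/-- A foliation is taut if every leaf meets a closed transversal. -/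
def IsTaut : Prop :=
  ∀ L : Set M, F.IsLeaf L → ∃ γ : ℝ → M, F.IsClosedTransversal γ ∧ (Set.range γ ∩ L).Nonempty

end CodimOneFoliation

/-- The closed curves `γ i` (1-periodic maps of `ℝ`) parametrize the set `S` as a link: each is an
embedding of the circle `ℝ / ℤ` of class `C^r`, their images are pairwise disjoint, and `S` is the
union of the images. -/
structure IsLinkParam (r : ℕ∞) (S : Set M) {n : ℕ} (γ : Fin n → ℝ → M) : Prop where
  contMDiff : ∀ i, ContMDiff 𝓘(ℝ, ℝ) (𝓡 3) r (γ i)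
  periodic : ∀ i, Function.Periodic (γ i) 1
  velocity_ne_zero : ∀ i t, mfderiv 𝓘(ℝ, ℝ) (𝓡 3) (γ i) t (1 : ℝ) ≠ 0
  injective : ∀ i j s t, γ i s = γ j t → i = j ∧ ∃ k : ℤ, s - t = k
  union_eq : (⋃ i, Set.range (γ i)) = S

/-- The fixed points of the flow of `X`. -/
def fixedPoints (X : (p : M) → TangentSpace (𝓡 3) p) : Set M := {p | X p = 0}

variable [IsManifold (𝓡 3) ∞ M]

/-- The linearization at `p` of a vector field `X` that vanishes at `p`, as an endomorphism of the
tangent space at `p` (which is `E3`): the derivative at `p` of `X` in the trivialization of the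
tangent bundle centred at `p`, which is the identity on the fibre over `p`. -/
noncomputable def linearization (X : (p : M) → TangentSpace (𝓡 3) p) (p : M) : E3 →L[ℝ] E3 :=
  mfderiv (𝓡 3) 𝓘(ℝ, E3) (fun q : M =>
    (trivializationAt E3 (TangentSpace (𝓡 3) : M → Type _) p
      (⟨q, X q⟩ : TangentBundle (𝓡 3) M)).2) p

/-- The transverse eigenvalues of `X` at a point `p` of a curve of fixed points. The linearization
annihilates the tangent line of the curve; the eigenvalues it induces on the quotient plane are its
own three complex eigenvalues, with multiplicity, with one eigenvalue `0` left out. -/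
noncomputable def transverseEigenvalues (X : (p : M) → TangentSpace (𝓡 3) p) (p : M) :
    Multiset ℂ :=
  (((linearization X p : E3 →ₗ[ℝ] E3).charpoly.map (algebraMap ℝ ℂ)).roots).erase 0

/-- Transverse hyperbolicity: no transverse eigenvalue is purely imaginary. -/
def IsTransversallyHyperbolic (X : (p : M) → TangentSpace (𝓡 3) p) (p : M) : Prop :=
  ∀ μ ∈ transverseEigenvalues X p, μ.re ≠ 0

/-- Codimension-one degeneracy of saddle-node type, along the curve `γ` of fixed points at the
parameter `t₀`: the transverse eigenvalues are real near `t₀`, and precisely one of them vanishes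
at `t₀`, where it changes sign with nonzero speed. -/
def IsSaddleNode (X : (p : M) → TangentSpace (𝓡 3) p) (γ : ℝ → M) (t₀ : ℝ) : Prop :=
  ∃ (a b : ℝ → ℝ) (b' : ℝ),
    (∀ᶠ t in nhds t₀, transverseEigenvalues X (γ t) = {(a t : ℂ), (b t : ℂ)}) ∧
    a t₀ ≠ 0 ∧ b t₀ = 0 ∧ HasDerivAt b b' t₀ ∧ b' ≠ 0

/-- Codimension-one degeneracy of Hopf type, along the curve `γ` of fixed points at the parameter
`t₀`: the transverse eigenvalues are complex conjugate near `t₀`, and at `t₀` they cross the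
imaginary axis, away from the origin and with nonzero speed. -/
def IsHopf (X : (p : M) → TangentSpace (𝓡 3) p) (γ : ℝ → M) (t₀ : ℝ) : Prop :=
  ∃ (a w : ℝ → ℝ) (a' : ℝ),
    (∀ᶠ t in nhds t₀, transverseEigenvalues X (γ t) =
      {(a t : ℂ) + w t * Complex.I, (a t : ℂ) - w t * Complex.I}) ∧
    w t₀ ≠ 0 ∧ a t₀ = 0 ∧ HasDerivAt a a' t₀ ∧ a' ≠ 0

/-- A `C^r` vector field (tangent to a plane field) is nondegenerate if its fixed point set is a
link at all but finitely many points of which it is transversally hyperbolic, the degeneracies at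
the exceptional points being of codimension one, that is, of saddle-node or of Hopf type. -/
def IsNondegenerate (r : ℕ∞) (X : (p : M) → TangentSpace (𝓡 3) p) : Prop :=
  ∃ (n : ℕ) (γ : Fin n → ℝ → M), IsLinkParam r (fixedPoints X) γ ∧
    {p | p ∈ fixedPoints X ∧ ¬ IsTransversallyHyperbolic X p}.Finite ∧
    ∀ i t, ¬ IsTransversallyHyperbolic X (γ i t) → IsSaddleNode X (γ i) t ∨ IsHopf X (γ i) t

/-- `X` is a gradient field: `X = -∇Ψ` for a `C^1` function `Ψ` and a Riemannian metric of class
`C^r`. -/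
def IsGradientField (r : ℕ∞) (X : (p : M) → TangentSpace (𝓡 3) p) : Prop :=
  ∃ (g : ContMDiffRiemannianMetric (𝓡 3) r E3 (TangentSpace (𝓡 3) : M → Type _)) (Ψ : M → ℝ),
    ContMDiff (𝓡 3) 𝓘(ℝ, ℝ) 1 Ψ ∧
    ∀ (p : M) (v : TangentSpace (𝓡 3) p), g.inner p (X p) v = -(mfderiv (𝓡 3) 𝓘(ℝ, ℝ) Ψ p v)

end

/-! The circles of zeros of `X` are themselves the closed transversals.

At a zero, let `A` be the linearization. Since `X` is tangent to the foliation, `A` takes values in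
the tangent plane of the leaf; since `X` is a gradient, `A` is symmetric for the metric, being minus
the Hessian of `Ψ` with an index raised. So the kernel of `A`, the orthogonal complement of its
image, contains the normal to the leaf. It also contains the velocity of the curve of zeros. At a
transversally hyperbolic point the kernel is at most a line, so the velocity is normal to the leaf.
The exceptional points are isolated on the curve, so orthogonality, a closed condition, persists
there (`velocity_notMem_tangentPlane`).

It remains to find a zero near each leaf. On the compact closure of a leaf `Ψ` has a minimum. The
closure is saturated, so `dΨ` vanishes along the leaf directions at the minimum, in particular on
`X`; thus `g(X, X) = -dΨ(X) = 0`, and the minimum lies on a circle of zeros. That circle is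
transverse to the foliation, hence meets all nearby plaques, and so the leaf itself. -/

/-! ### Linear algebra and calculus at a zero of a vector field -/

/-- If a symmetric endomorphism (with respect to a positive definite form `B`) takes values in the
kernel of `l` and has a kernel of dimension at most one, then its kernel is `B`-orthogonal to the
kernel of `l`. -/
theorem orthogonal_ker_of_finrank_ker_le_one {E : Type*} [NormedAddCommGroup E] [NormedSpace ℝ E]
    [FiniteDimensional ℝ E] (A : E →L[ℝ] E) (B : E →L[ℝ] E →L[ℝ] ℝ) (l : E →L[ℝ] ℝ)
    (hpos : ∀ v, v ≠ 0 → 0 < B v v) (hsymm : ∀ v w, B v w = B w v)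
    (hA : ∀ v w, B (A v) w = B (A w) v) (hl : ∀ v, l (A v) = 0)
    (hker : Module.finrank ℝ (LinearMap.ker (A : E →ₗ[ℝ] E)) ≤ 1) {u : E} (hu : A u = 0)
    (v w : E) : B u v * l w = B u w * l v := by
  let B' : E →ₗ[ℝ] (E →L[ℝ] ℝ) := B
  have hinj : Function.Injective B' := by
    rw [← LinearMap.ker_eq_bot, LinearMap.ker_eq_bot']
    intro x hx
    by_contra hx0
    have := hpos x hx0
    have h2 : B x = 0 := hx
    rw [h2] at this
    simp at this
  have hdim : Module.finrank ℝ E = Module.finrank ℝ (E →L[ℝ] ℝ) := by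
    rw [← (LinearMap.toContinuousLinearMap (𝕜 := ℝ) (E := E) (F' := ℝ)).finrank_eq]
    exact (Subspace.dual_finrank_eq (K := ℝ) (V := E)).symm
  -- `n` is the normal to `ker l`: the vector that represents `l` through `B`.
  obtain ⟨n, hn⟩ := (LinearMap.injective_iff_surjective_of_finrank_eq_finrank hdim).1 hinj l
  have hn' : ∀ x, B n x = l x := fun x => by rw [← hn]; rfl
  -- `B (A n) (A n) = B n (A (A n)) = l (A (A n)) = 0`.
  have hAn : A n = 0 := by
    by_contra h0
    have h1 := hpos _ h0
    rw [hA, hsymm, hn', hl] at h1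
    exact lt_irrefl _ h1
  by_cases hn0 : n = 0
  · simp [← hn', hn0]
  have hnk : (⟨n, hAn⟩ : LinearMap.ker (A : E →ₗ[ℝ] E)) ≠ 0 := by
    simpa [Subtype.ext_iff] using hn0
  have hfr := finrank_eq_one_iff_of_nonzero' _ hnk |>.1
    (le_antisymm hker (Module.finrank_pos_iff_exists_ne_zero.2 ⟨_, hnk⟩))
  obtain ⟨c, hc⟩ := hfr ⟨u, hu⟩
  have hc' : u = c • n := by simpa using (congrArg Subtype.val hc).symm
  rw [hc']
  simp [hn']
  ring

/-- If `0` is at most a simple root of the characteristic polynomial, the kernel is at most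
one-dimensional. -/
theorem finrank_ker_le_rootMultiplicity_charpoly {K V : Type*} [Field K] [AddCommGroup V]
    [Module K V] [FiniteDimensional K V] (f : V →ₗ[K] V) :
    Module.finrank K (LinearMap.ker f) ≤ f.charpoly.rootMultiplicity 0 := by
  have h : LinearMap.ker f = Module.End.genEigenspace f 0 1 := by
    ext x
    simp
  rw [h]
  exact LinearMap.finrank_genEigenspace_le f 0 1

/-- The derivative of a product at a zero of the second factor: the first factor need only be
continuous there. -/
theorem HasFDerivAt.clm_apply_of_continuousAt {E F G : Type*} [NormedAddCommGroup E]
    [NormedSpace ℝ E] [NormedAddCommGroup F] [NormedSpace ℝ F] [NormedAddCommGroup G]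
    [NormedSpace ℝ G] {f : E → F} {A : E →L[ℝ] F} {c : E → F →L[ℝ] G} {x : E}
    (hf : HasFDerivAt f A x) (h0 : f x = 0) (hc : ContinuousAt c x) :
    HasFDerivAt (fun y => c y (f y)) ((c x).comp A) x := by
  -- Split `c y = c x + (c y - c x)`: the second part contributes `o(1) * O(y - x)`.
  have h1 : HasFDerivAt (fun y => c x (f y)) ((c x).comp A) x := (c x).hasFDerivAt.comp x hf
  have h2 : HasFDerivAt (fun y => (c y - c x) (f y)) (0 : E →L[ℝ] G) x := by
    rw [hasFDerivAt_iff_isLittleO]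
    simp only [h0, map_zero, sub_zero, zero_apply]
    have hO : f =O[nhds x] fun y => y - x := by
      simpa [h0] using hf.isBigO_sub
    have ho : (fun y => c y - c x) =o[nhds x] fun _ => (1 : ℝ) := by
      rw [Asymptotics.isLittleO_one_iff]
      exact tendsto_sub_nhds_zero_iff.2 hc
    have h3 : (fun y => (c y - c x) (f y)) =O[nhds x] fun y => ‖c y - c x‖ * ‖f y‖ :=
      Asymptotics.IsBigO.of_norm_le fun y => (c y - c x).le_opNorm (f y)
    refine h3.trans_isLittleO ?_
    simpa using ho.norm_left.mul_isBigO hO.norm_norm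
  have h3 := h1.add h2
  simp only [add_zero] at h3
  refine h3.congr_of_eventuallyEq (Filter.Eventually.of_forall fun y => ?_)
  simp

/-- Local form of the two properties of the linearization `A` of a vector field `X` at a zero: it
takes values in the plane field `ker l` to which `X` is tangent, and it is symmetric if `X` is a
gradient field. -/
theorem linearization_apply_mem_ker {E : Type*} [NormedAddCommGroup E] [NormedSpace ℝ E]
    {X : E → E} {A : E →L[ℝ] E} {l : E → E →L[ℝ] ℝ} {x : E} (hX : HasFDerivAt X A x) (h0 : X x = 0)
    (hl : ContinuousAt l x) (hlX : ∀ᶠ y in nhds x, l y (X y) = 0) (v : E) : l x (A v) = 0 := by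
  have h1 := hX.clm_apply_of_continuousAt h0 hl
  have h2 : HasFDerivAt (fun y => l y (X y)) (0 : E →L[ℝ] ℝ) x :=
    (hasFDerivAt_const (0 : ℝ) x).congr_of_eventuallyEq hlX
  simpa using congrArg (fun f : E →L[ℝ] ℝ => f v) (h1.unique h2)

/-- At a zero of `X` the derivative of `-G(X)` is `-G x ∘ A`, without a term from the derivative of
`G`. It is the second derivative of `ψ`, hence symmetric; for this it is enough that `dψ` exist near
`x` and be differentiable at `x`. -/
theorem linearization_symmetric {E : Type*} [NormedAddCommGroup E] [NormedSpace ℝ E]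
    {X : E → E} {A : E →L[ℝ] E} {G : E → E →L[ℝ] E →L[ℝ] ℝ} {ψ : E → ℝ} {x : E}
    (hX : HasFDerivAt X A x) (h0 : X x = 0) (hG : ContinuousAt G x)
    (hψ : ∀ᶠ y in nhds x, HasFDerivAt ψ (-(G y (X y))) y) (v w : E) :
    G x (A v) w = G x (A w) v := by
  have h1 := (hX.clm_apply_of_continuousAt h0 hG).neg
  simpa using second_derivative_symmetric_of_eventually (𝕜 := ℝ) hψ h1 v w

/-! ### The linearization and the metric in coordinates -/

section

variable {M : Type*} [TopologicalSpace M] [ChartedSpace E3 M] [IsManifold (𝓡 3) ∞ M]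

/-- After one root `0` is erased none is left, so `0` is at most a simple root of the characteristic
polynomial, which bounds the kernel. -/
theorem IsTransversallyHyperbolic.finrank_ker_le_one {X : (p : M) → TangentSpace (𝓡 3) p} {p : M}
    (h : IsTransversallyHyperbolic X p) :
    Module.finrank ℝ (LinearMap.ker (linearization X p : E3 →ₗ[ℝ] E3)) ≤ 1 := by
  refine (finrank_ker_le_rootMultiplicity_charpoly _).trans ?_
  set P := (linearization X p : E3 →ₗ[ℝ] E3).charpoly with hP
  have h1 : P.rootMultiplicity 0 = (P.map (algebraMap ℝ ℂ)).rootMultiplicity 0 := by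
    simpa using Polynomial.eq_rootMultiplicity_map (p := P) (algebraMap ℝ ℂ).injective 0
  have h2 : (0 : ℂ) ∉ (P.map (algebraMap ℝ ℂ)).roots.erase 0 := fun h0 => h 0 h0 rfl
  rw [h1, ← Polynomial.count_roots]
  have h3 := Multiset.count_eq_zero.2 h2
  -- Truncated subtraction: `count - 1 = 0` says `count ≤ 1`.
  rw [Multiset.count_erase_self] at h3
  omega

/-- The coordinate frame on the tangent spaces given by the chart centred at `p`. -/
noncomputable def chartFrame (p q : M) : E3 →L[ℝ] TangentSpace (𝓡 3) q :=
  (trivializationAt E3 (TangentSpace (𝓡 3) : M → Type _) p).symmL ℝ q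

theorem chartFrame_eq_mfderiv {p q : M} (hq : q ∈ (chartAt E3 p).source) :
    chartFrame p q =
      mfderiv 𝓘(ℝ, E3) (𝓡 3) (extChartAt (𝓡 3) p).symm (extChartAt (𝓡 3) p q) := by
  have := TangentBundle.symmL_trivializationAt (I := 𝓡 3) (𝕜 := ℝ) hq
  rw [ModelWithCorners.Boundaryless.range_eq_univ, mfderivWithin_univ] at this
  exact this

theorem chartFrame_self (p : M) (v : E3) : chartFrame p p v = v := by
  have h := TangentBundle.symmL_trivializationAt (I := 𝓡 3) (𝕜 := ℝ) (mem_chart_source E3 p)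
  have h2 := mfderivWithin_range_extChartAt_symm (I := 𝓡 3) (x := p)
  rw [h2] at h
  exact congrArg (fun f : E3 →L[ℝ] E3 => f v) h

theorem chartFrame_apply_trivialization {p q : M} (hq : q ∈ (chartAt E3 p).source)
    (v : TangentSpace (𝓡 3) q) :
    chartFrame p q (trivializationAt E3 (TangentSpace (𝓡 3) : M → Type _) p
      (⟨q, v⟩ : TangentBundle (𝓡 3) M)).2 = v := by
  set e := trivializationAt E3 (TangentSpace (𝓡 3) : M → Type _) p
  have hq' : q ∈ e.baseSet := hq
  have := e.symmL_continuousLinearMapAt (R := ℝ) hq' v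
  rw [e.continuousLinearMapAt_apply (R := ℝ), e.coe_linearMapAt_of_mem (R := ℝ) hq'] at this
  exact this

theorem chartFrame_bijective {p q : M} (hq : q ∈ (chartAt E3 p).source) :
    Function.Bijective (chartFrame p q) := by
  set e := trivializationAt E3 (TangentSpace (𝓡 3) : M → Type _) p
  have hq' : q ∈ e.baseSet := hq
  have := (e.continuousLinearEquivAt ℝ q hq').symm.bijective
  rwa [e.symm_continuousLinearEquivAt_eq hq'] at this

/-- The frame is the derivative of the inverse chart, so this is the chain rule; it turns
differentials on `M` into Fréchet derivatives on `E3`. -/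
theorem hasFDerivAt_comp_extChartAt_symm {f : M → ℝ} {p q : M} (hq : q ∈ (chartAt E3 p).source)
    (hf : MDifferentiableAt (𝓡 3) 𝓘(ℝ, ℝ) f q) :
    HasFDerivAt (f ∘ (extChartAt (𝓡 3) p).symm)
      ((mfderiv (𝓡 3) 𝓘(ℝ, ℝ) f q).comp (chartFrame p q)) (extChartAt (𝓡 3) p q) := by
  have hq' : q ∈ (extChartAt (𝓡 3) p).source := by simpa using hq
  have h1 : MDifferentiableAt 𝓘(ℝ, E3) (𝓡 3) (extChartAt (𝓡 3) p).symm
      (extChartAt (𝓡 3) p q) := by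
    have := mdifferentiableWithinAt_extChartAt_symm (I := 𝓡 3)
      ((extChartAt (𝓡 3) p).map_source hq')
    rwa [ModelWithCorners.Boundaryless.range_eq_univ, mdifferentiableWithinAt_univ] at this
  have h2 := h1.hasMFDerivAt
  rw [← chartFrame_eq_mfderiv hq] at h2
  have h3 := hf.hasMFDerivAt
  have h4 : HasMFDerivAt (𝓡 3) 𝓘(ℝ, ℝ) f ((extChartAt (𝓡 3) p).symm (extChartAt (𝓡 3) p q))
      (mfderiv (𝓡 3) 𝓘(ℝ, ℝ) f q) := by
    rw [(extChartAt (𝓡 3) p).left_inv hq']; exact h3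
  exact (HasMFDerivAt.comp _ h4 h2).hasFDerivAt

/-- The linearization is the derivative of the vector field in the trivialization at `p`. -/
theorem hasMFDerivAt_linearization {r : ℕ∞} (hr : 1 ≤ r) {X : (p : M) → TangentSpace (𝓡 3) p}
    (hX : ContMDiff (𝓡 3) (𝓡 3).tangent r (fun p : M => (⟨p, X p⟩ : TangentBundle (𝓡 3) M)))
    (p : M) :
    HasMFDerivAt (𝓡 3) 𝓘(ℝ, E3) (fun q : M =>
      (trivializationAt E3 (TangentSpace (𝓡 3) : M → Type _) p
        (⟨q, X q⟩ : TangentBundle (𝓡 3) M)).2) p (linearization X p) := by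
  have h1 : ContMDiffAt (𝓡 3) 𝓘(ℝ, E3) r (fun q : M =>
      (trivializationAt E3 (TangentSpace (𝓡 3) : M → Type _) p
        (⟨q, X q⟩ : TangentBundle (𝓡 3) M)).2) p :=
    (contMDiffAt_section p).1 (hX p)
  have hr' : ((r : ℕ∞) : WithTop ℕ∞) ≠ 0 := by
    have : r ≠ 0 := by rintro rfl; simp at hr
    exact_mod_cast this
  exact (h1.mdifferentiableAt hr').hasMFDerivAt

/-- The metric in coordinates. -/
noncomputable def metricInChart {r : ℕ∞}
    (g : ContMDiffRiemannianMetric (𝓡 3) r E3 (TangentSpace (𝓡 3) : M → Type _)) (p q : M) :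
    E3 →L[ℝ] E3 →L[ℝ] ℝ :=
  let B : E3 →L[ℝ] E3 →L[ℝ] ℝ := g.inner q
  let f : E3 →L[ℝ] E3 := chartFrame p q
  B.bilinearComp f f

theorem metricInChart_apply {r : ℕ∞}
    (g : ContMDiffRiemannianMetric (𝓡 3) r E3 (TangentSpace (𝓡 3) : M → Type _)) (p q : M)
    (v w : E3) :
    metricInChart g p q v w = g.inner q (chartFrame p q v) (chartFrame p q w) := rfl

theorem continuousOn_chartFrame (p : M) (v : E3) :
    ContinuousOn (fun q => (⟨q, chartFrame p q v⟩ : TangentBundle (𝓡 3) M))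
      (chartAt E3 p).source := by
  set e := trivializationAt E3 (TangentSpace (𝓡 3) : M → Type _) p
  have h : ContinuousOn (fun q : M => e.toOpenPartialHomeomorph.symm (q, v)) e.baseSet := by
    refine e.toOpenPartialHomeomorph.continuousOn_symm.comp
      (Continuous.prodMk_left v).continuousOn ?_
    intro q hq
    exact e.mem_target.2 hq
  refine h.congr fun q hq => ?_
  exact (congrArg (fun z => (⟨q, z⟩ : TangentBundle (𝓡 3) M)) (e.symmL_apply hq v)).trans
    (e.mk_symm (b := q) hq v)

theorem continuousOn_metricInChart {r : ℕ∞}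
    (g : ContMDiffRiemannianMetric (𝓡 3) r E3 (TangentSpace (𝓡 3) : M → Type _)) (p : M) :
    ContinuousOn (metricInChart g p) (chartAt E3 p).source := by
  rw [continuousOn_clm_apply]
  intro v
  rw [continuousOn_clm_apply]
  intro w
  have hv := contMDiffOn_zero_iff (I := 𝓡 3) (I' := (𝓡 3).tangent) |>.2
    (continuousOn_chartFrame p v)
  have hw := contMDiffOn_zero_iff (I := 𝓡 3) (I' := (𝓡 3).tangent) |>.2
    (continuousOn_chartFrame p w)
  have hg : ContMDiffOn (𝓡 3) ((𝓡 3).prod 𝓘(ℝ, E3 →L[ℝ] E3 →L[ℝ] ℝ)) 0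
    (fun b ↦ TotalSpace.mk' (E3 →L[ℝ] E3 →L[ℝ] ℝ)
      (E := fun b : M => TangentSpace (𝓡 3) b →L[ℝ] TangentSpace (𝓡 3) b →L[ℝ] ℝ) b (g.inner b))
      (chartAt E3 p).source :=
    (g.contMDiff.of_le bot_le).contMDiffOn
  have := ContMDiffOn.clm_bundle_apply₂ (F₁ := E3) (F₂ := E3) (F₃ := ℝ)
    (E₃ := Bundle.Trivial M ℝ) hg hv hw
  intro q hq
  have h1 := (contMDiffWithinAt_totalSpace.1 (this q hq)).2
  simpa [metricInChart_apply] using! h1.continuousWithinAt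

theorem one_le_coe_of_one_le {r : ℕ∞} (hr : 1 ≤ r) : (1 : WithTop ℕ∞) ≤ (r : WithTop ℕ∞) := by
  exact_mod_cast hr

/-! ### Orthogonality to the leaves at hyperbolic zeros -/

namespace CodimOneFoliation

variable {r : ℕ∞} (F : CodimOneFoliation r M)

omit [IsManifold (𝓡 3) ∞ M] in
theorem contMDiffOn_snd {φ : OpenPartialHomeomorph M FolModel} (hφ : φ ∈ F.charts) :
    ContMDiffOn (𝓡 3) 𝓘(ℝ, ℝ) r (fun q : M => (φ q).2) φ.source :=
  (contDiff_snd (𝕜 := ℝ) (E := EuclideanSpace ℝ (Fin 2)) (F := ℝ)).contMDiff.comp_contMDiffOn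
    (F.contMDiffOn φ hφ)

omit [IsManifold (𝓡 3) ∞ M] in
theorem mdifferentiableAt_snd (hr : 1 ≤ r) {φ : OpenPartialHomeomorph M FolModel}
    (hφ : φ ∈ F.charts) {p : M} (hp : p ∈ φ.source) :
    MDifferentiableAt (𝓡 3) 𝓘(ℝ, ℝ) (fun q : M => (φ q).2) p :=
  ((F.contMDiffOn_snd hφ).contMDiffAt (φ.open_source.mem_nhds hp)).mdifferentiableAt
    (one_le_coe_of_one_le hr |>.trans_lt' zero_lt_one).ne'

/-- The differential of the transverse coordinate of `φ`. -/
noncomputable def transverseDifferential (φ : OpenPartialHomeomorph M FolModel) (q : M) :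
    TangentSpace (𝓡 3) q →L[ℝ] ℝ :=
  mfderiv (𝓡 3) 𝓘(ℝ, ℝ) (fun q : M => (φ q).2) q

/-- The differential of the transverse coordinate of `φ`, in the chart centred at `p`. -/
noncomputable def conormal (φ : OpenPartialHomeomorph M FolModel) (p q : M) : E3 →L[ℝ] ℝ :=
  (transverseDifferential φ q).comp (chartFrame p q)

/-- Near `p` the conormal is the Fréchet derivative of a `C^1` function, the transverse coordinate
read in the chart at `p`. -/
theorem continuousAt_conormal (hr : 1 ≤ r) {φ : OpenPartialHomeomorph M FolModel}
    (hφ : φ ∈ F.charts) {p : M} (hp : p ∈ φ.source) :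
    ContinuousAt (conormal φ p) p := by
  set ψ : E3 → M := ⇑(extChartAt (𝓡 3) p).symm with hψ
  let f : E3 → ℝ := fun y => (φ (ψ y)).2
  have h1 : ContMDiffAt 𝓘(ℝ, E3) 𝓘(ℝ, ℝ) 1 f (extChartAt (𝓡 3) p p) := by
    have h2 : ContMDiffAt 𝓘(ℝ, E3) (𝓡 3) 1 ψ (extChartAt (𝓡 3) p p) :=
      ((contMDiffOn_extChartAt_symm (I := 𝓡 3) (n := ∞) p).contMDiffAt
        (extChartAt_target_mem_nhds p)).of_le (by exact_mod_cast le_top)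
    refine ContMDiffAt.comp (g := fun q : M => (φ q).2) _ ?_ h2
    rw [hψ, extChartAt_to_inv]
    exact (((F.contMDiffOn_snd hφ).contMDiffAt (φ.open_source.mem_nhds hp))).of_le
      (one_le_coe_of_one_le hr)
  have h3 : ContinuousAt (fderiv ℝ f) (extChartAt (𝓡 3) p p) :=
    (h1.contDiffAt.fderiv_right (m := 0) (by simp)).continuousAt
  have h4 := ContinuousAt.comp (g := fderiv ℝ f) h3
    (continuousAt_extChartAt (I := 𝓡 3) p)
  refine h4.congr ?_
  filter_upwards [chart_source_mem_nhds E3 p, φ.open_source.mem_nhds hp] with q hq hqφ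
  have h5 : HasFDerivAt f (conormal φ p q) (extChartAt (𝓡 3) p q) :=
    hasFDerivAt_comp_extChartAt_symm hq (F.mdifferentiableAt_snd hr hφ hqφ)
  exact h5.fderiv

/-- At a transversally hyperbolic zero of a gradient field tangent to the foliation, the kernel of
the linearization is orthogonal to the leaves. -/
theorem orthogonal_of_linearization_eq_zero (hr : 1 ≤ r) {X : (p : M) → TangentSpace (𝓡 3) p}
    (hX : ContMDiff (𝓡 3) (𝓡 3).tangent r (fun p : M => (⟨p, X p⟩ : TangentBundle (𝓡 3) M)))
    (hF : F.Contains X)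
    (g : ContMDiffRiemannianMetric (𝓡 3) r E3 (TangentSpace (𝓡 3) : M → Type _)) {Ψ : M → ℝ}
    (hΨ : ContMDiff (𝓡 3) 𝓘(ℝ, ℝ) 1 Ψ)
    (hgrad : ∀ (p : M) (v : TangentSpace (𝓡 3) p),
      g.inner p (X p) v = -(mfderiv (𝓡 3) 𝓘(ℝ, ℝ) Ψ p v))
    {p : M} (hp : X p = 0) (hyp : IsTransversallyHyperbolic X p)
    {φ : OpenPartialHomeomorph M FolModel} (hφ : φ ∈ F.charts) (hpφ : p ∈ φ.source)
    {u : TangentSpace (𝓡 3) p} (hu : linearization X p u = 0) (v w : TangentSpace (𝓡 3) p) :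
    g.inner p u v * transverseDifferential φ p w =
      g.inner p u w * transverseDifferential φ p v := by
  set y₀ : E3 := extChartAt (𝓡 3) p p with hy₀
  set ψ : E3 → M := ⇑(extChartAt (𝓡 3) p).symm with hψ
  have hψ₀ : ψ y₀ = p := extChartAt_to_inv p
  have hψc : ContinuousAt ψ y₀ := continuousAt_extChartAt_symm p
  let Y : E3 → E3 := fun y => (trivializationAt E3 (TangentSpace (𝓡 3) : M → Type _) p
    (⟨ψ y, X (ψ y)⟩ : TangentBundle (𝓡 3) M)).2
  have hframe : ∀ q ∈ (chartAt E3 p).source, ∀ y, ψ y = q → chartFrame p q (Y y) = X q := by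
    rintro q hq y rfl
    exact chartFrame_apply_trivialization hq _
  have hY₀ : Y y₀ = 0 := by
    have h := hframe p (mem_chart_source E3 p) y₀ hψ₀
    rw [chartFrame_self, hp] at h
    exact h
  -- `Y` is `X` read in the chart at `p`, and a manifold derivative at `p` is by definition the
  -- derivative in that chart.
  have hY : HasFDerivAt Y (linearization X p) y₀ := by
    have h := (hasMFDerivAt_linearization hr hX p).2
    rw [ModelWithCorners.Boundaryless.range_eq_univ] at h
    exact HasFDerivWithinAt.hasFDerivAt_of_univ h
  have hnhds : ∀ᶠ y in nhds y₀, ψ y ∈ (chartAt E3 p).source ∧ ψ y ∈ φ.source ∧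
      y ∈ (extChartAt (𝓡 3) p).target := by
    refine (hψc.eventually ?_).and ((hψc.eventually ?_).and (extChartAt_target_mem_nhds p))
    · rw [hψ₀]; exact chart_source_mem_nhds E3 p
    · rw [hψ₀]; exact φ.open_source.mem_nhds hpφ
  have hl : ContinuousAt (fun y => conormal φ p (ψ y)) y₀ :=
    ContinuousAt.comp (g := conormal φ p) (by rw [hψ₀]; exact F.continuousAt_conormal hr hφ hpφ)
      hψc
  have hG : ContinuousAt (fun y => metricInChart g p (ψ y)) y₀ :=
    ContinuousAt.comp (g := metricInChart g p)
      (by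
        rw [hψ₀]
        exact (continuousOn_metricInChart g p).continuousAt (chart_source_mem_nhds E3 p)) hψc
  have hlA := linearization_apply_mem_ker hY hY₀ hl <| by
    filter_upwards [hnhds] with y hy
    change transverseDifferential φ (ψ y) (chartFrame p (ψ y) (Y y)) = 0
    rw [hframe _ hy.1 y rfl]
    exact hF (ψ y) φ hφ hy.2.1
  have hsym := linearization_symmetric (ψ := Ψ ∘ ψ) hY hY₀ hG <| by
    filter_upwards [hnhds] with y hy
    have h := hasFDerivAt_comp_extChartAt_symm hy.1
      (hΨ.mdifferentiableAt (by simp) (x := ψ y))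
    rw [(extChartAt (𝓡 3) p).right_inv hy.2.2] at h
    refine h.congr_fderiv ?_
    ext w
    change mfderiv (𝓡 3) 𝓘(ℝ, ℝ) Ψ (ψ y) (chartFrame p (ψ y) w) =
      -(g.inner (ψ y) (chartFrame p (ψ y) (Y y)) (chartFrame p (ψ y) w))
    rw [hframe _ hy.1 y rfl, hgrad]
    exact (neg_neg (G := ℝ) _).symm
  simp only [hψ₀] at hlA hsym
  have hmet : ∀ a b : E3, metricInChart g p p a b = g.inner p a b := by
    intro a b
    rw [metricInChart_apply, chartFrame_self, chartFrame_self]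
  have hcon : ∀ a : E3, conormal φ p p a =
      transverseDifferential φ p a := by
    intro a
    change transverseDifferential φ p (chartFrame p p a) = _
    rw [chartFrame_self]
  have := orthogonal_ker_of_finrank_ker_le_one (linearization X p) (metricInChart g p p)
    (conormal φ p p) (fun a ha => by rw [hmet]; exact g.pos p a ha)
    (fun a b => by rw [hmet, hmet]; exact g.symm p a b) hsym hlA hyp.finrank_ker_le_one hu v w
  rwa [hmet u v, hmet u w, hcon v, hcon w] at this

end CodimOneFoliation

/-- The linearization annihilates the velocity of a curve of zeros. -/
theorem linearization_velocity_eq_zero {r : ℕ∞} (hr : 1 ≤ r) {X : (p : M) → TangentSpace (𝓡 3) p}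
    (hX : ContMDiff (𝓡 3) (𝓡 3).tangent r (fun p : M => (⟨p, X p⟩ : TangentBundle (𝓡 3) M)))
    {γ : ℝ → M} {t : ℝ} (hγ : MDifferentiableAt 𝓘(ℝ, ℝ) (𝓡 3) γ t) (h0 : ∀ s, X (γ s) = 0) :
    linearization X (γ t) (mfderiv 𝓘(ℝ, ℝ) (𝓡 3) γ t (1 : ℝ)) = 0 := by
  let B : ℝ →L[ℝ] E3 := (linearization X (γ t)).comp (mfderiv 𝓘(ℝ, ℝ) (𝓡 3) γ t)
  have h2 : HasFDerivAt (fun s => (trivializationAt E3 (TangentSpace (𝓡 3) : M → Type _) (γ t)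
      (⟨γ s, X (γ s)⟩ : TangentBundle (𝓡 3) M)).2) B t :=
    hasMFDerivAt_iff_hasFDerivAt.1
      ((hasMFDerivAt_linearization hr hX (γ t)).comp t hγ.hasMFDerivAt)
  have h3 : HasFDerivAt (fun _ : ℝ => (0 : E3)) (0 : ℝ →L[ℝ] E3) t := hasFDerivAt_const _ _
  have hev : (fun s => (trivializationAt E3 (TangentSpace (𝓡 3) : M → Type _) (γ t)
      (⟨γ s, X (γ s)⟩ : TangentBundle (𝓡 3) M)).2) =ᶠ[nhds t] fun _ => (0 : E3) := by
    filter_upwards [hγ.continuousAt.eventually (chart_source_mem_nhds E3 (γ t))] with s hs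
    apply (chartFrame_bijective hs).1
    rw [chartFrame_apply_trivialization hs, h0, map_zero]
  have := (h2.congr_of_eventuallyEq hev.symm).unique h3
  exact congrArg (fun f : ℝ →L[ℝ] E3 => f 1) this

end

/-! ### Links, plaques and closures of leaves -/

section

variable {M : Type*} [TopologicalSpace M] [ChartedSpace E3 M]

section Link

variable {r : ℕ∞} {S : Set M} {n : ℕ} {γ : Fin n → ℝ → M}

theorem IsLinkParam.mem (h : IsLinkParam r S γ) (i : Fin n) (t : ℝ) : γ i t ∈ S := by
  rw [← h.union_eq]
  exact Set.mem_iUnion.2 ⟨i, t, rfl⟩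

/-- The parameters of the points of a finite set on a link are isolated. -/
theorem IsLinkParam.eventually_notMem (h : IsLinkParam r S γ) {T : Set M} (hT : T.Finite)
    (i : Fin n) (t₀ : ℝ) : ∀ᶠ t in nhdsWithin t₀ {t₀}ᶜ, γ i t ∉ T := by
  -- On an open window of length one, two parameters of the same point differ by an integer of
  -- absolute value less than one.
  have hinj : Set.InjOn (γ i) (γ i ⁻¹' T ∩ Set.Ioo (t₀ - 1 / 2) (t₀ + 1 / 2)) := by
    rintro s ⟨-, hs⟩ t ⟨-, ht⟩ hst
    obtain ⟨-, k, hk⟩ := h.injective i i s t hst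
    have h1 : (k : ℝ) < 1 := by rw [← hk]; linarith [hs.2, ht.1]
    have h2 : (-1 : ℝ) < k := by rw [← hk]; linarith [hs.1, ht.2]
    have h3 : k = 0 := by
      have h1' : k < 1 := by exact_mod_cast h1
      have h2' : -1 < k := by exact_mod_cast h2
      omega
    rw [h3, Int.cast_zero] at hk
    linarith
  have hfin : (γ i ⁻¹' T ∩ Set.Ioo (t₀ - 1 / 2) (t₀ + 1 / 2)).Finite :=
    Set.Finite.of_finite_image (hT.subset (by rintro _ ⟨s, hs, rfl⟩; exact hs.1)) hinj
  have h1 : ∀ᶠ t in nhdsWithin t₀ {t₀}ᶜ,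
      t ∉ (γ i ⁻¹' T ∩ Set.Ioo (t₀ - 1 / 2) (t₀ + 1 / 2)) \ {t₀} :=
    nhdsWithin_le_nhds
      ((hfin.subset Set.sdiff_subset).isClosed.isOpen_compl.mem_nhds fun h => h.2 rfl)
  have h2 : ∀ᶠ t in nhdsWithin t₀ {t₀}ᶜ, t ∈ Set.Ioo (t₀ - 1 / 2) (t₀ + 1 / 2) :=
    nhdsWithin_le_nhds (Ioo_mem_nhds (by linarith) (by linarith))
  filter_upwards [h1, h2, self_mem_nhdsWithin] with t ht1 ht2 hne ht
  exact ht1 ⟨⟨ht, ht2⟩, hne⟩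

end Link

namespace CodimOneFoliation

variable {r : ℕ∞} (F : CodimOneFoliation r M)

theorem mdifferentiableAt_chart (hr : 1 ≤ r) {φ : OpenPartialHomeomorph M FolModel}
    (hφ : φ ∈ F.charts) {p : M} (hp : p ∈ φ.source) :
    MDifferentiableAt (𝓡 3) 𝓘(ℝ, FolModel) φ p :=
  ((F.contMDiffOn φ hφ).contMDiffAt (φ.open_source.mem_nhds hp)).mdifferentiableAt
    (one_le_coe_of_one_le hr |>.trans_lt' zero_lt_one).ne'

theorem mdifferentiableAt_chart_symm (hr : 1 ≤ r) {φ : OpenPartialHomeomorph M FolModel}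
    (hφ : φ ∈ F.charts) (x : FolModel) :
    MDifferentiableAt 𝓘(ℝ, FolModel) (𝓡 3) φ.symm x :=
  ((F.contMDiffOn_symm φ hφ).contMDiffAt
    (φ.open_target.mem_nhds (by rw [F.target_eq φ hφ]; trivial))).mdifferentiableAt
    (one_le_coe_of_one_le hr |>.trans_lt' zero_lt_one).ne'

theorem transverseDifferential_eq_snd (hr : 1 ≤ r) {φ : OpenPartialHomeomorph M FolModel}
    (hφ : φ ∈ F.charts) {p : M} (hp : p ∈ φ.source) (v : TangentSpace (𝓡 3) p) :
    transverseDifferential φ p v =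
      (show FolModel from mfderiv (𝓡 3) 𝓘(ℝ, FolModel) φ p v).2 := by
  have h1 : HasMFDerivAt 𝓘(ℝ, FolModel) 𝓘(ℝ, ℝ) (Prod.snd : FolModel → ℝ) (φ p)
      (ContinuousLinearMap.snd ℝ (EuclideanSpace ℝ (Fin 2)) ℝ) :=
    hasMFDerivAt_iff_hasFDerivAt.2 hasFDerivAt_snd
  have h2 := h1.comp p (F.mdifferentiableAt_chart hr hφ hp).hasMFDerivAt
  exact congrArg (fun f : E3 →L[ℝ] ℝ => f v) h2.mfderiv

/-- Along `φ.symm` the transverse coordinate is the projection `Prod.snd`, whose derivative takes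
the value `1` at `(0, 1)`. -/
theorem exists_transverseDifferential_ne_zero (hr : 1 ≤ r)
    {φ : OpenPartialHomeomorph M FolModel} (hφ : φ ∈ F.charts) {p : M} (hp : p ∈ φ.source) :
    ∃ w, transverseDifferential φ p w ≠ 0 := by
  have h1 := (F.mdifferentiableAt_chart_symm hr hφ (φ p)).hasMFDerivAt
  have h2 : HasMFDerivAt (𝓡 3) 𝓘(ℝ, ℝ) (fun q : M => (φ q).2) (φ.symm (φ p))
      (transverseDifferential φ (φ.symm (φ p))) := by
    rw [φ.left_inv hp]
    exact (F.mdifferentiableAt_snd hr hφ hp).hasMFDerivAt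
  have h3 := h2.comp (φ p) h1
  have h4 : HasMFDerivAt 𝓘(ℝ, FolModel) 𝓘(ℝ, ℝ) (Prod.snd : FolModel → ℝ) (φ p)
      (ContinuousLinearMap.snd ℝ (EuclideanSpace ℝ (Fin 2)) ℝ) :=
    hasMFDerivAt_iff_hasFDerivAt.2 hasFDerivAt_snd
  have h5 : (fun q : M => (φ q).2) ∘ φ.symm = Prod.snd := by
    ext x
    simp [φ.right_inv (x := x) (by rw [F.target_eq φ hφ]; trivial)]
  rw [h5] at h3
  have h6 := congrArg (fun f : FolModel →L[ℝ] ℝ => f (0, 1)) (hasMFDerivAt_unique h3 h4)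
  refine ⟨mfderiv 𝓘(ℝ, FolModel) (𝓡 3) φ.symm (φ p) ((0, 1) : FolModel), fun h0 => ?_⟩
  have h7 : transverseDifferential φ (φ.symm (φ p))
      (mfderiv 𝓘(ℝ, FolModel) (𝓡 3) φ.symm (φ p) ((0, 1) : FolModel)) = 1 := h6
  have key : ∀ q (v : E3), q = p → transverseDifferential φ q v = transverseDifferential φ p v := by
    rintro q v rfl
    rfl
  exact one_ne_zero (h7.symm.trans ((key _ _ (φ.left_inv hp)).trans h0))

theorem mem_leaf_of_samePlaque {x p q : M} (hp : p ∈ F.leaf x) (h : F.SamePlaque p q) :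
    q ∈ F.leaf x :=
  Relation.EqvGen.trans _ _ _ hp (Relation.EqvGen.rel _ _ h)

/-- The closure of a leaf is saturated. -/
theorem mem_closure_leaf_of_samePlaque {x p q : M} (hp : p ∈ closure (F.leaf x))
    (h : F.SamePlaque p q) : q ∈ closure (F.leaf x) := by
  obtain ⟨φ, hφ, hpφ, hqφ, h⟩ := h
  have htgt : ∀ y, y ∈ φ.target := fun y => by rw [F.target_eq φ hφ]; trivial
  -- This map slides each point inside its plaque to the horizontal position of `q`. It sends `p` to
  -- `q`, so leaf points near `p` go to leaf points near `q`.
  have hc : ContinuousAt (fun p' => φ.symm ((φ q).1, (φ p').2)) p := by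
    have h1 : ContinuousAt φ.symm ((φ q).1, (φ p).2) := φ.continuousAt_symm (htgt _)
    have h2 : ContinuousAt (fun p' => (((φ q).1, (φ p').2) : FolModel)) p :=
      continuousAt_const.prodMk (φ.continuousAt hpφ).snd
    exact ContinuousAt.comp (f := fun p' => (((φ q).1, (φ p').2) : FolModel)) h1 h2
  have hq : φ.symm ((φ q).1, (φ p).2) = q := by rw [h]; exact φ.left_inv hqφ
  rw [mem_closure_iff_nhds] at hp ⊢
  intro U hU
  rw [← hq] at hU
  obtain ⟨p', ⟨hU', hs⟩, hL⟩ :=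
    hp _ (Filter.inter_mem (hc.preimage_mem_nhds hU) (φ.open_source.mem_nhds hpφ))
  refine ⟨_, hU', F.mem_leaf_of_samePlaque hL ⟨φ, hφ, hs, φ.map_target (htgt _), ?_⟩⟩
  rw [φ.right_inv (htgt _)]

/-- A function that has a minimum on the closure of a leaf is stationary there in the directions
tangent to the foliation. -/
theorem mfderiv_eq_zero_of_isMinOn_closure_leaf (hr : 1 ≤ r) {Ψ : M → ℝ}
    (hΨ : ContMDiff (𝓡 3) 𝓘(ℝ, ℝ) 1 Ψ) {x m : M} (hm : m ∈ closure (F.leaf x))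
    (hmin : IsMinOn Ψ (closure (F.leaf x)) m) {v : TangentSpace (𝓡 3) m}
    (hv : v ∈ F.tangentPlane m) : mfderiv (𝓡 3) 𝓘(ℝ, ℝ) Ψ m v = 0 := by
  obtain ⟨φ, hφ, hmφ⟩ := F.cover m
  have htgt : ∀ y, y ∈ φ.target := fun y => by rw [F.target_eq φ hφ]; trivial
  have hsymm := F.mdifferentiableAt_chart_symm hr hφ (φ m)
  have hd : MDifferentiableAt 𝓘(ℝ, FolModel) 𝓘(ℝ, ℝ) (Ψ ∘ φ.symm) (φ m) :=
    (hΨ.mdifferentiableAt (by simp)).comp _ hsymm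
  have hd' : DifferentiableAt ℝ (Ψ ∘ φ.symm) (φ m) := hd.differentiableAt
  have h1 : HasMFDerivAt (𝓡 3) 𝓘(ℝ, ℝ) ((Ψ ∘ φ.symm) ∘ φ) m
      ((fderiv ℝ (Ψ ∘ φ.symm) (φ m)).comp (mfderiv (𝓡 3) 𝓘(ℝ, FolModel) φ m)) :=
    HasMFDerivAt.comp m (hasMFDerivAt_iff_hasFDerivAt.2 hd'.hasFDerivAt)
      (F.mdifferentiableAt_chart hr hφ hmφ).hasMFDerivAt
  have h2 : Ψ =ᶠ[nhds m] (Ψ ∘ φ.symm) ∘ φ := by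
    filter_upwards [φ.open_source.mem_nhds hmφ] with q hq
    simp [φ.left_inv hq]
  let d : FolModel := mfderiv (𝓡 3) 𝓘(ℝ, FolModel) φ m v
  have h3 : mfderiv (𝓡 3) 𝓘(ℝ, ℝ) Ψ m v = fderiv ℝ (Ψ ∘ φ.symm) (φ m) d :=
    congrArg (fun f : E3 →L[ℝ] ℝ => f v) (h1.congr_of_eventuallyEq h2).mfderiv
  rw [h3]
  have hd2 : d.2 = 0 :=
    (F.transverseDifferential_eq_snd hr hφ hmφ v).symm.trans (hv φ hφ hmφ)
  -- Since `d.2 = 0` and the chart is onto the model, the entire line in direction `d` lies in one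
  -- plaque, hence in the closure of the leaf, and `t = 0` is a minimum along it.
  have h4 : HasDerivAt (fun t : ℝ => φ m + t • d) d 0 := by
    simpa using ((hasDerivAt_id (0 : ℝ)).smul_const d).const_add (φ m)
  have h5 : HasDerivAt (fun t : ℝ => (Ψ ∘ φ.symm) (φ m + t • d))
      (fderiv ℝ (Ψ ∘ φ.symm) (φ m) d) 0 :=
    HasFDerivAt.comp_hasDerivAt (l := Ψ ∘ φ.symm) 0 (by simpa using hd'.hasFDerivAt) h4
  refine IsLocalMin.hasDerivAt_eq_zero (Filter.Eventually.of_forall fun t => ?_) h5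
  have h6 : φ.symm (φ m + t • d) ∈ closure (F.leaf x) := by
    refine F.mem_closure_leaf_of_samePlaque hm ⟨φ, hφ, hmφ, φ.map_target (htgt _), ?_⟩
    rw [φ.right_inv (htgt _)]
    simp [hd2]
  have h7 : Ψ m ≤ Ψ (φ.symm (φ m + t • d)) := hmin h6
  simpa [φ.left_inv hmφ] using h7

/-- A transverse curve through a point of the closure of a leaf meets the leaf. -/
theorem range_inter_leaf_nonempty (hr : 1 ≤ r) {γ : ℝ → M} {t₀ : ℝ}
    (hγ : ContMDiff 𝓘(ℝ, ℝ) (𝓡 3) r γ)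
    (ht : mfderiv 𝓘(ℝ, ℝ) (𝓡 3) γ t₀ (1 : ℝ) ∉ F.tangentPlane (γ t₀)) {x : M}
    (hx : γ t₀ ∈ closure (F.leaf x)) : (Set.range γ ∩ F.leaf x).Nonempty := by
  have hr' := one_le_coe_of_one_le hr
  obtain ⟨φ, hφ, hs, hne⟩ : ∃ φ ∈ F.charts, γ t₀ ∈ φ.source ∧
      transverseDifferential φ (γ t₀) (mfderiv 𝓘(ℝ, ℝ) (𝓡 3) γ t₀ (1 : ℝ)) ≠ 0 := by
    by_contra! hcon
    exact ht fun φ hφ hp => hcon φ hφ hp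
  let f : ℝ → ℝ := fun t => (φ (γ t)).2
  have hf : ContMDiffAt 𝓘(ℝ, ℝ) 𝓘(ℝ, ℝ) 1 f t₀ :=
    (((F.contMDiffOn_snd hφ).contMDiffAt (φ.open_source.mem_nhds hs)).of_le hr').comp t₀
      (hγ.contMDiffAt.of_le hr')
  have hstrict : HasStrictDerivAt f (deriv f t₀) t₀ :=
    hf.contDiffAt.hasStrictDerivAt (by simp)
  let B : ℝ →L[ℝ] ℝ := (transverseDifferential φ (γ t₀)).comp (mfderiv 𝓘(ℝ, ℝ) (𝓡 3) γ t₀)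
  have hB : HasFDerivAt f B t₀ :=
    hasMFDerivAt_iff_hasFDerivAt.1 (HasMFDerivAt.comp (g := fun q : M => (φ q).2) t₀
      (F.mdifferentiableAt_snd hr hφ hs).hasMFDerivAt
      (hγ.mdifferentiableAt (hr'.trans_lt' zero_lt_one).ne').hasMFDerivAt)
  have hderiv : deriv f t₀ ≠ 0 := by
    rw [hB.hasDerivAt.deriv]
    exact hne
  -- A nonzero strict derivative makes `f` open at `t₀`: near `t₀` the curve reaches every
  -- transverse coordinate close to `f t₀`, including that of some leaf point near `γ t₀`.
  have hmap := hstrict.map_nhds_eq hderiv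
  have h1 : f '' (γ ⁻¹' φ.source) ∈ nhds (f t₀) := by
    rw [← hmap]
    exact Filter.image_mem_map
      (hγ.continuous.continuousAt.preimage_mem_nhds (φ.open_source.mem_nhds hs))
  have h2 : ContinuousAt (fun q => (φ q).2) (γ t₀) := (φ.continuousAt hs).snd
  obtain ⟨q, ⟨⟨t, htφ, htq⟩, hqs⟩, hqL⟩ := mem_closure_iff_nhds.1 hx _
    (Filter.inter_mem (h2.preimage_mem_nhds h1) (φ.open_source.mem_nhds hs))
  exact ⟨γ t, ⟨t, rfl⟩, F.mem_leaf_of_samePlaque hqL ⟨φ, hφ, hqs, htφ, htq.symm⟩⟩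

end CodimOneFoliation

end

/-! ### Transversality of the curves of zeros -/

section

variable {M : Type*} [TopologicalSpace M] [ChartedSpace E3 M] [IsManifold (𝓡 3) ∞ M]

/-- The velocity of a `C^1` curve is continuous as a map to the tangent bundle. -/
theorem continuous_velocity {γ : ℝ → M} (hγ : ContMDiff 𝓘(ℝ, ℝ) (𝓡 3) 1 γ) :
    Continuous (fun t : ℝ => (⟨γ t, mfderiv 𝓘(ℝ, ℝ) (𝓡 3) γ t (1 : ℝ)⟩ : TangentBundle (𝓡 3) M)) := by
  have h1 := hγ.continuous_tangentMap le_rfl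
  have h2 : Continuous (fun t : ℝ => (tangentBundleModelSpaceHomeomorph 𝓘(ℝ, ℝ)).symm (t, (1 : ℝ))) :=
    (tangentBundleModelSpaceHomeomorph 𝓘(ℝ, ℝ)).symm.continuous.comp (Continuous.prodMk_left 1)
  exact h1.comp h2

/-- The curves of zeros of a nondegenerate gradient field tangent to a foliation are transverse to
the foliation: they are orthogonal to the leaves at the transversally hyperbolic points, hence, by
continuity, also at the isolated exceptional ones. -/
theorem CodimOneFoliation.velocity_notMem_tangentPlane {r : ℕ∞} (F : CodimOneFoliation r M)
    (hr : 1 ≤ r) {X : (p : M) → TangentSpace (𝓡 3) p}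
    (hX : ContMDiff (𝓡 3) (𝓡 3).tangent r (fun p : M => (⟨p, X p⟩ : TangentBundle (𝓡 3) M)))
    (hF : F.Contains X) (hgrad : IsGradientField r X) {n : ℕ} {γ : Fin n → ℝ → M}
    (hγ : IsLinkParam r (fixedPoints X) γ)
    (hfin : {p | p ∈ fixedPoints X ∧ ¬ IsTransversallyHyperbolic X p}.Finite) (i : Fin n)
    (t₀ : ℝ) : mfderiv 𝓘(ℝ, ℝ) (𝓡 3) (γ i) t₀ (1 : ℝ) ∉ F.tangentPlane (γ i t₀) := by
  obtain ⟨g, Ψ, hΨ, hgrad⟩ := hgrad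
  have hr' := one_le_coe_of_one_le hr
  have hγ1 : ContMDiff 𝓘(ℝ, ℝ) (𝓡 3) 1 (γ i) := (hγ.contMDiff i).of_le hr'
  have hγd : ∀ t, MDifferentiableAt 𝓘(ℝ, ℝ) (𝓡 3) (γ i) t :=
    fun t => hγ1.mdifferentiableAt (by simp)
  have hγc : ContinuousAt (γ i) t₀ := (hγd t₀).continuousAt
  set p := γ i t₀ with hp
  obtain ⟨φ, hφ, hpφ⟩ := F.cover p
  -- All velocities are read in the trivialization at the fixed point `p`, so that a limit in `t`
  -- makes sense.
  let u : ℝ → E3 := fun t => (trivializationAt E3 (TangentSpace (𝓡 3) : M → Type _) p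
    (⟨γ i t, mfderiv 𝓘(ℝ, ℝ) (𝓡 3) (γ i) t (1 : ℝ)⟩ : TangentBundle (𝓡 3) M)).2
  have hu : ContinuousAt u t₀ :=
    ((FiberBundle.continuousAt_totalSpace E3 _).1 (continuous_velocity hγ1).continuousAt).2
  have hG : ContinuousAt (fun t => metricInChart g p (γ i t)) t₀ :=
    ContinuousAt.comp (g := metricInChart g p)
      ((continuousOn_metricInChart g p).continuousAt (chart_source_mem_nhds E3 p)) hγc
  have hl : ContinuousAt (fun t => conormal φ p (γ i t)) t₀ :=
    ContinuousAt.comp (g := conormal φ p) (F.continuousAt_conormal hr hφ hpφ) hγc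
  -- The identity says that the covectors `g(u, ·)` and `l` are proportional. It holds off `t₀`,
  -- where the points are hyperbolic, and passes to the limit.
  have hev : ∀ᶠ t in nhdsWithin t₀ {t₀}ᶜ, ∀ v w : E3,
      metricInChart g p (γ i t) (u t) v * conormal φ p (γ i t) w =
        metricInChart g p (γ i t) (u t) w * conormal φ p (γ i t) v := by
    filter_upwards [hγ.eventually_notMem hfin i t₀,
      nhdsWithin_le_nhds (hγc.eventually (φ.open_source.mem_nhds hpφ)),
      nhdsWithin_le_nhds (hγc.eventually (chart_source_mem_nhds E3 p))] with t ht hts htc v w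
    have hfix : ∀ s, X (γ i s) = 0 := hγ.mem i
    have hyp : IsTransversallyHyperbolic X (γ i t) := by
      by_contra hcon
      exact ht ⟨hfix t, hcon⟩
    have := F.orthogonal_of_linearization_eq_zero hr hX hF g hΨ hgrad (hfix t) hyp hφ hts
      (linearization_velocity_eq_zero hr hX (hγd t) hfix) (chartFrame p (γ i t) v)
      (chartFrame p (γ i t) w)
    rw [metricInChart_apply, metricInChart_apply, chartFrame_apply_trivialization htc]
    exact this
  have key : ∀ v w : E3, metricInChart g p p (u t₀) v * conormal φ p p w =
      metricInChart g p p (u t₀) w * conormal φ p p v := by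
    intro v w
    have h : ∀ a b : E3, Filter.Tendsto
        (fun t => metricInChart g p (γ i t) (u t) a * conormal φ p (γ i t) b)
        (nhdsWithin t₀ {t₀}ᶜ) (nhds (metricInChart g p p (u t₀) a * conormal φ p p b)) :=
      fun a b => (((hG.clm_apply hu).clm_apply continuousAt_const).mul
        (hl.clm_apply continuousAt_const)).tendsto.mono_left nhdsWithin_le_nhds
    exact tendsto_nhds_unique_of_eventuallyEq (h v w) (h w v) (hev.mono fun t ht => ht v w)
  have hut : chartFrame p p (u t₀) = mfderiv 𝓘(ℝ, ℝ) (𝓡 3) (γ i) t₀ (1 : ℝ) :=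
    chartFrame_apply_trivialization (mem_chart_source E3 p) _
  intro hmem
  obtain ⟨w, hw⟩ := F.exists_transverseDifferential_ne_zero hr hφ hpφ
  obtain ⟨w', rfl⟩ := (chartFrame_bijective (mem_chart_source E3 p)).2 w
  have h0 : conormal φ p p (u t₀) = 0 := by
    change transverseDifferential φ p (chartFrame p p (u t₀)) = 0
    rw [hut]
    exact hmem φ hφ hpφ
  -- If the velocity `u` were tangent, `g(u, u) * l(w) = g(u, w) * l(u) = 0`, although both factors
  -- on the left are nonzero.
  have h1 := key (u t₀) w'
  rw [h0, mul_zero, metricInChart_apply, hut] at h1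
  exact (mul_ne_zero (g.pos p _ (hγ.velocity_ne_zero i t₀)).ne' hw) h1

end

/-! ### Tautness -/

theorem theorem5p1 {M : Type*} [TopologicalSpace M] [T2Space M] [CompactSpace M]
    [ChartedSpace E3 M] [IsManifold (𝓡 3) ∞ M]
    (r : ℕ∞) (hr : 1 ≤ r) (F : CodimOneFoliation r M)
    (X : (p : M) → TangentSpace (𝓡 3) p)
    (hX : ContMDiff (𝓡 3) (𝓡 3).tangent r (fun p : M => (⟨p, X p⟩ : TangentBundle (𝓡 3) M)))
    (hF : F.Contains X) (hgrad : IsGradientField r X) (hnd : IsNondegenerate r X) :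
    F.IsTaut := by
  obtain ⟨n, γ, hγ, hfin, -⟩ := hnd
  have htrans := F.velocity_notMem_tangentPlane hr hX hF hgrad hγ hfin
  obtain ⟨g, Ψ, hΨ, hgrad⟩ := hgrad
  rintro _ ⟨x, rfl⟩
  obtain ⟨m, hm, hmin⟩ := (isClosed_closure (s := F.leaf x)).isCompact.exists_isMinOn
    ⟨x, subset_closure (Relation.EqvGen.refl x)⟩ hΨ.continuous.continuousOn
  have hm0 : m ∈ fixedPoints X := by
    by_contra h
    have h1 := g.pos m (X m) h
    rw [hgrad, F.mfderiv_eq_zero_of_isMinOn_closure_leaf hr hΨ hm hmin (hF m)] at h1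
    exact lt_irrefl (0 : ℝ) (h1.trans_eq (neg_zero (G := ℝ)))
  rw [← hγ.union_eq] at hm0
  obtain ⟨i, t₀, rfl⟩ := Set.mem_iUnion.1 hm0
  exact ⟨γ i, ⟨hγ.contMDiff i, hγ.periodic i, htrans i⟩,
    F.range_inter_leaf_nonempty hr (hγ.contMDiff i) (htrans i t₀) hm⟩
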